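/- **Setting.** Terms of the linear substitution calculus (LSC), up to $\alpha$-equivalence, are $t,u ::= x \mid \lambda x.t \mid t\,u \mid t[x{\leftarrow}u]$, where the explicit substitution $t[x{\leftarrow}u]$ binds $x$ in $t$; bound names are kept distinct from each other and from the free names. General contexts $C ::= \langle\cdot\rangle \mid \lambda x.C \mid C\,t \mid t\,C \mid C[x{\leftarrow}t] \mid t[x{\leftarrow}C]$ have one hole; a context is *shallow* if it is built without the last clause; substitution contexts are $L ::= \langle\cdot\rangle \mid L[x{\leftarrow}t]$. Plugging $C\langle t\rangle$ may capture variables. The root rules are $$L\langle\lambda x.t\rangle\,u \mapsto_{\mathtt{dB}} L\langle t[x{\leftarrow}u]\rangle, \qquad C\langle x\rangle[x{\leftarrow}u]\mapsto_{\mathtt{ls}} C\langle u\rangle[x{\leftarrow}u]\ (C \text{ not capturing } x).$$ LSC steps are their closure by general contexts; a redex is identified with its position, which is $C$ for a $\mathtt{dB}$-redex $C\langle r\rangle$, and $E=F\langle C[x{\leftarrow}u]\rangle$ for an $\mathtt{ls}$-redex $F\langle C\langle x\rangle[x{\leftarrow}u]\rangle=E\langle x\rangle\to E\langle u\rangle$.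 A redex is shallow if its position is. The order $\prec_{LO}$ on positions is the union of $\prec_O$ and $\prec_L$, the least relations closed under plugging both sides into a same context and such that: $\langle\cdot\rangle\prec_O C$ for $C\neq\langle\cdot\rangle$; and, if $C$ and $D$ are contexts of subterms of $t$ and $u$ respectively (i.e. $t=C\langle t'\rangle$ and $u=D\langle u'\rangle$ for some $t',u'$), $C\,u\prec_L t\,D$ and $C[x{\leftarrow}u]\prec_L t[x{\leftarrow}D]$. The unfolding $t{\downarrow}$ of $t$ is the $\lambda$-term obtained by performing all explicit substitutions of $t$. The unfolding $t{\downarrow_C}$ of $t$ relative to a shallow context $C$ is given by $t{\downarrow_{\langle\cdot\rangle}}=t{\downarrow}$, $t{\downarrow_{\lambda x.C}}=t{\downarrow_{u\,C}}=t{\downarrow_{C\,u}}=t{\downarrow_C}$ and $t{\downarrow_{C[x{\leftarrow}u]}}=t{\downarrow_C}\{x{\leftarrow}u{\downarrow}\}$. A shallow redex is *useful* if it is a $\mathtt{dB}$-redex, or an $\mathtt{ls}$-redex $C\langle x\rangle\to C\langle r\rangle$ (position $C$) such that either $r{\downarrow_C}$ contains a $\beta$-redex, or $r{\downarrow_C}$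 is an abstraction and $C=D\langle L\,t\rangle$ for some shallow $D$, substitution context $L$ and term $t$. It is *useless* if it is a shallow $\mathtt{ls}$-redex that is not useful. The *leftmost-outermost useful (LOU) redex* of $t$ is the useful redex $C$ of $t$ such that $C\prec_{LO}D$ for every other useful redex $D$ of $t$; a LOU derivation is a finite sequence of steps each of which reduces the LOU redex. *Residuals:* the residuals of a redex $D$ of $t$ after a step $t\to t'$ are the redexes of $t'$ whose anchor is a copy of the anchor of $D$, where the anchor of an $\mathtt{ls}$-redex is the variable occurrence to be replaced and that of a $\mathtt{dB}$-redex is its abstraction; residuals after a derivation are obtained by iteration. A derivation $C_1;\dots;C_n$ is *standard* if, for every $i\in\{2,\dots,n\}$ and $j<i$, $C_i$ is not a residual (after $C_j;\dots;C_{i-1}$) of an LSC redex $D$, shallow or not, of the source of $C_j$ with $D\prec_{LO}C_j$. **Proposition.** Every leftmost-outermost useful derivation, from any term of the LSC, is a standard LSC derivation. Moreover, useless persistence holds: let $R$ be a useless redex of $t$ and $Q:t\to p$ a useful step with $R\prec_{LO}Q$. Then $R$ has exactly one residual $R'$ after $Q$, and 1. $R'$ is shallow and useless; 2. if $Q$ is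 the LOU redex of $t$ and $P$ is the LOU redex of $p$, then $R'\prec_{LO}P$. -/

import Mathlib

namespace LSC

/-- Terms of the linear substitution calculus, up to α-equivalence, with de Bruijn indices:
`lam` binds index `0` of its body, and `es t u` is the explicit substitution `t[x ← u]`, which
binds index `0` of `t` (not of `u`). Variable occurrences and abstractions carry a label in `A`:
ordinary terms are those with trivial labels (`LTerm` below), labels in `Bool` are used to trace
redexes along reduction steps. -/
inductive Term (A : Type) : Type
  | var (a : A) (n : ℕ) : Term A
  | lam (a : A) (t : Term A) : Term A
  | app (t u : Term A) : Term A
  | es (t u : Term A) : Term A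

/-- General (not necessarily shallow) one-hole contexts. -/
inductive Ctx (A : Type) : Type
  | hole : Ctx A
  | lam (a : A) (C : Ctx A) : Ctx A
  | appL (C : Ctx A) (u : Term A) : Ctx A
  | appR (t : Term A) (C : Ctx A) : Ctx A
  | esL (C : Ctx A) (u : Term A) : Ctx A
  | esR (t : Term A) (C : Ctx A) : Ctx A

/-- Ordinary terms of the LSC. -/
abbrev LTerm := Term Unit

/-- Ordinary contexts of the LSC; redexes are identified with their position, a context. -/
abbrev LCtx := Ctx Unit

namespace Term

/-- `t.shift c k` adds `k` to all free variables of `t` with index at least `c`. -/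
def shift {A : Type} : Term A → ℕ → ℕ → Term A
  | var a n, c, k => var a (if n < c then n else n + k)
  | lam a t, c, k => lam a (t.shift (c + 1) k)
  | app t u, c, k => app (t.shift c k) (u.shift c k)
  | es t u, c, k => es (t.shift (c + 1) k) (u.shift c k)

/-- Forget the labels. -/
def erase {A : Type} : Term A → LTerm
  | var _ n => var () n
  | lam _ t => lam () t.erase
  | app t u => app t.erase u.erase
  | es t u => es t.erase u.erase

/-- The number of constructors of a `Bool`-labelled term that are marked, i.e. labelled `true`. -/
def markCount : Term Bool → ℕ
  | var a _ => a.toNat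
  | lam a t => a.toNat + t.markCount
  | app t u => t.markCount + u.markCount
  | es t u => t.markCount + u.markCount

end Term

namespace Ctx

/-- Plugging a term in a context (the binders of the context capture). -/
def plug {A : Type} : Ctx A → Term A → Term A
  | hole, s => s
  | lam a C, s => Term.lam a (C.plug s)
  | appL C u, s => Term.app (C.plug s) u
  | appR t C, s => Term.app t (C.plug s)
  | esL C u, s => Term.es (C.plug s) u
  | esR t C, s => Term.es t (C.plug s)

/-- Plugging a context in a context. -/
def comp {A : Type} : Ctx A → Ctx A → Ctx A
  | hole, D => D
  | lam a C, D => lam a (C.comp D)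
  | appL C u, D => appL (C.comp D) u
  | appR t C, D => appR t (C.comp D)
  | esL C u, D => esL (C.comp D) u
  | esR t C, D => esR t (C.comp D)

/-- Forget the labels. -/
def erase {A : Type} : Ctx A → LCtx
  | hole => hole
  | lam _ C => lam () C.erase
  | appL C u => appL C.erase u.erase
  | appR t C => appR t.erase C.erase
  | esL C u => esL C.erase u.erase
  | esR t C => esR t.erase C.erase

/-- The number of binders (abstractions and explicit substitutions) with the hole in their
scope. -/
def depth {A : Type} : Ctx A → ℕ
  | hole => 0
  | lam _ C => C.depth + 1
  | appL C _ => C.depth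
  | appR _ C => C.depth
  | esL C _ => C.depth + 1
  | esR _ C => C.depth

/-- The number of abstractions with the hole in their scope. -/
def lamDepth {A : Type} : Ctx A → ℕ
  | hole => 0
  | lam _ C => C.lamDepth + 1
  | appL C _ => C.lamDepth
  | appR _ C => C.lamDepth
  | esL C _ => C.lamDepth
  | esR _ C => C.lamDepth

/-- Shallow contexts: the hole is not inside the content of an explicit substitution. -/
def Shallow {A : Type} : Ctx A → Prop
  | hole => True
  | lam _ C => C.Shallow
  | appL C _ => C.Shallow
  | appR _ C => C.Shallow
  | esL C _ => C.Shallow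
  | esR _ _ => False

/-- Substitution contexts `L ::= ⟨·⟩ | L[x ← t]`. -/
def IsSubst {A : Type} : Ctx A → Prop
  | hole => True
  | esL C _ => C.IsSubst
  | _ => False

/-- Applicative contexts `C⟨L t⟩`, with `C` shallow and `L` a substitution context. -/
def Applicative {A : Type} (C : Ctx A) : Prop :=
  ∃ (D L : Ctx A) (t : Term A), D.Shallow ∧ L.IsSubst ∧ C = D.comp (appL L t)

/-- The prefix relation between contexts and terms. -/
def PrefixOf {A : Type} (C : Ctx A) (t : Term A) : Prop :=
  ∃ s : Term A, C.plug s = t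

end Ctx

/-! ### Reduction -/

/-- The root rule at a distance `L⟨λx.t⟩ u ↦ L⟨t[x ← u]⟩`. -/
inductive RootDB {A : Type} : Term A → Term A → Prop
  | intro (L : Ctx A) (hL : L.IsSubst) (a : A) (t u : Term A) :
      RootDB (Term.app (L.plug (Term.lam a t)) u) (L.plug (Term.es t (u.shift 0 L.depth)))

/-- `C` is the position of a `dB`-redex of `t`. -/
def IsDB {A : Type} (t : Term A) (C : Ctx A) : Prop :=
  ∃ r r' : Term A, RootDB r r' ∧ t = C.plug r

/-- `t = C⟨x⟩`, where `C = F⟨G[x ← u]⟩` and `G` does not capture `x`, and `r` is `u` seen in the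
scope of the hole of `C`: so `C` is the position of a linear substitution redex of `t`, whose
compact form is `C⟨x⟩ → C⟨r⟩`. -/
def IsLS {A : Type} (t : Term A) (C : Ctx A) (r : Term A) : Prop :=
  ∃ (F G : Ctx A) (u : Term A) (a : A),
    C = F.comp (Ctx.esL G u) ∧ t = C.plug (Term.var a G.depth) ∧ r = u.shift 0 (G.depth + 1)

/-- A step `t → t'` of the LSC (`dB` or `ls`, closed by general contexts) of position `C`.
The step is shallow when `C` is. -/
def Step {A : Type} (t : Term A) (C : Ctx A) (t' : Term A) : Prop :=
  (∃ r r' : Term A, RootDB r r' ∧ t = C.plug r ∧ t' = C.plug r') ∨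
  (∃ r : Term A, IsLS t C r ∧ t' = C.plug r)

/-- `C` is (the position of) an LSC redex of `t`, not necessarily shallow. -/
def IsRedex (t : LTerm) (C : LCtx) : Prop :=
  ∃ t' : LTerm, Step t C t'

/-! ### The left-to-right outside-in order -/

/-- The outside-in order. -/
inductive OutIn : LCtx → LCtx → Prop
  | root (C : LCtx) : C ≠ Ctx.hole → OutIn Ctx.hole C
  | closure (E C D : LCtx) : OutIn C D → OutIn (E.comp C) (E.comp D)

/-- The left-to-right order. -/
inductive LeftRight : LCtx → LCtx → Prop
  | app (C D : LCtx) (t u : LTerm) : C.PrefixOf t → D.PrefixOf u →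
      LeftRight (Ctx.appL C u) (Ctx.appR t D)
  | es (C D : LCtx) (t u : LTerm) : C.PrefixOf t → D.PrefixOf u →
      LeftRight (Ctx.esL C u) (Ctx.esR t D)
  | closure (E C D : LCtx) : LeftRight C D → LeftRight (E.comp C) (E.comp D)

/-- The left-to-right outside-in order. -/
def LeftOut (C D : LCtx) : Prop :=
  OutIn C D ∨ LeftRight C D

/-! ### Unfoldings and usefulness -/

/-- Ordinary `λ`-terms, with de Bruijn indices. -/
inductive Lam : Type
  | var (n : ℕ) : Lam
  | lam (t : Lam) : Lam
  | app (t u : Lam) : Lam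

namespace Lam

/-- `t.shift c k` adds `k` to all free variables of `t` with index at least `c`. -/
def shift : Lam → ℕ → ℕ → Lam
  | var n, c, k => var (if n < c then n else n + k)
  | lam t, c, k => lam (t.shift (c + 1) k)
  | app t u, c, k => app (t.shift c k) (u.shift c k)

/-- `t.subst d u` replaces the variable `d` of `t` by `u`, where `u` lives outside the `d`
innermost binders and outside the binder of the variable `d`; the latter binder is removed. -/
def subst : Lam → ℕ → Lam → Lam
  | var n, d, u => if n < d then var n else if n = d then u.shift 0 d else var (n - 1)
  | lam t, d, u => lam (t.subst (d + 1) u)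
  | app t s, d, u => app (t.subst d u) (s.subst d u)

/-- The term is an abstraction. -/
def IsAbs (t : Lam) : Prop :=
  ∃ s : Lam, t = lam s

/-- The term contains a `β`-redex. -/
def HasBetaRedex : Lam → Prop
  | var _ => False
  | lam t => t.HasBetaRedex
  | app t u => t.IsAbs ∨ t.HasBetaRedex ∨ u.HasBetaRedex

end Lam

/-- The unfolding of a term. -/
def Term.unfold {A : Type} : Term A → Lam
  | Term.var _ n => Lam.var n
  | Term.lam _ t => Lam.lam t.unfold
  | Term.app t u => Lam.app t.unfold u.unfold
  | Term.es t u => t.unfold.subst 0 u.unfold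

/-- The unfolding of the term `t` relative to a shallow context: the explicit substitutions of the
context having the hole in their scope are applied to the unfolding of `t`, while the variables
bound by the abstractions of the context stay free in the result. Hence in the clause for
`C[x ← u]` the variable `x` has index `C.lamDepth` in the unfolding relative to `C`. The last
clause is never used on shallow contexts. -/
def relUnfold {A : Type} (t : Term A) : Ctx A → Lam
  | Ctx.hole => t.unfold
  | Ctx.lam _ C => relUnfold t C
  | Ctx.appL C _ => relUnfold t C
  | Ctx.appR _ C => relUnfold t C
  | Ctx.esL C u => (relUnfold t C).subst C.lamDepth u.unfold
  | Ctx.esR _ C => relUnfold t C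

/-- Useful redexes: shallow `dB`-redexes, and shallow `ls`-redexes `C⟨x⟩ → C⟨r⟩` satisfying
relative duplication or relative creation. -/
def IsUseful (t : LTerm) (C : LCtx) : Prop :=
  C.Shallow ∧ (IsDB t C ∨ ∃ r : LTerm, IsLS t C r ∧
    ((relUnfold r C).HasBetaRedex ∨ ((relUnfold r C).IsAbs ∧ C.Applicative)))

/-- Useless redexes: shallow `ls`-redexes that are not useful. -/
def IsUseless (t : LTerm) (C : LCtx) : Prop :=
  C.Shallow ∧ (∃ r : LTerm, IsLS t C r) ∧ ¬ IsUseful t C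

/-- The leftmost-outermost useful redex of `t`. -/
def IsLOU (t : LTerm) (C : LCtx) : Prop :=
  IsUseful t C ∧ ∀ D : LCtx, IsUseful t D → D ≠ C → LeftOut C D

/-! ### Residuals -/

/-- The anchor of the redex of position `D` is marked in `T`: the anchor of an `ls`-redex is its
variable occurrence, the anchor of a `dB`-redex is its abstraction. -/
def AnchorMarked (T : Term Bool) (D : LCtx) : Prop :=
  ∃ D₁ : Ctx Bool, D₁.erase = D ∧
    ((∃ n : ℕ, T = D₁.plug (Term.var true n)) ∨
     (∃ (L : Ctx Bool) (s u : Term Bool), L.IsSubst ∧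
        T = D₁.plug (Term.app (L.plug (Term.lam true s)) u)))

/-- The redex `D'` of `t'` is a residual of the redex `D` of `t` after the step `t → t'` of
position `C`: mark the anchor of `D` in `t`, and nothing else, and perform the step on the marked
term, copying the marks along with the subterms that carry them; then the anchor of `D'` is
marked. -/
def Residual (t : LTerm) (C : LCtx) (t' : LTerm) (D D' : LCtx) : Prop :=
  IsRedex t D ∧ IsRedex t' D' ∧
  ∃ (T T' : Term Bool) (C₁ : Ctx Bool),
    T.erase = t ∧ C₁.erase = C ∧ T'.erase = t' ∧
    T.markCount = 1 ∧ AnchorMarked T D ∧ Step T C₁ T' ∧ AnchorMarked T' D'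

/-! ### Derivations -/

/-- `Deriv t ρ u`: `ρ`, the list of positions of the reduced redexes, is an LSC derivation from
`t` to `u`. -/
inductive Deriv : LTerm → List LCtx → LTerm → Prop
  | nil (t : LTerm) : Deriv t [] t
  | cons (t s u : LTerm) (C : LCtx) (ρ : List LCtx) :
      Step t C s → Deriv s ρ u → Deriv t (C :: ρ) u

/-- Leftmost-outermost useful derivations: every step reduces the leftmost-outermost useful
redex. -/
inductive LOUDeriv : LTerm → List LCtx → LTerm → Prop
  | nil (t : LTerm) : LOUDeriv t [] t
  | cons (t s u : LTerm) (C : LCtx) (ρ : List LCtx) :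
      IsLOU t C → Step t C s → LOUDeriv s ρ u → LOUDeriv t (C :: ρ) u

/-- `ResidualAfter t ρ D D'`: `D'` is a residual of the redex `D` of `t` after the derivation
`ρ` starting from `t`. -/
inductive ResidualAfter : LTerm → List LCtx → LCtx → LCtx → Prop
  | nil (t : LTerm) (D : LCtx) : ResidualAfter t [] D D
  | cons (t s : LTerm) (C : LCtx) (ρ : List LCtx) (D E D' : LCtx) :
      Step t C s → Residual t C s D E → ResidualAfter s ρ E D' → ResidualAfter t (C :: ρ) D D'

/-- The derivation `ρ` starting from `t` is standard: whenever `C` and `E` are steps of it, `E`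
after `C`, the redex `E` is not a residual of an LSC redex `D`, shallow or not, of the source of
`C` such that `D` precedes `C` in the left-to-right outside-in order. -/
def Standard (t : LTerm) (ρ : List LCtx) : Prop :=
  ∀ (τ σ ω : List LCtx) (C E : LCtx), ρ = τ ++ C :: (σ ++ E :: ω) →
    ∀ s : LTerm, Deriv t τ s →
      ∀ D : LCtx, IsRedex s D → LeftOut D C → ¬ ResidualAfter s (C :: σ) D E

end LSC

/-!
A redex `D` that is not useful and precedes a shallow redex `Q` can only sit to the left of it: an
`ls`-redex is positioned at a variable occurrence, with nothing inside; a `dB`-redex outside a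
shallow position is shallow, hence useful; and `Q` is not in the content of an explicit
substitution. So `D = H⟨B u⟩` and `Q = H⟨s C⟩` for some application `s u` of the term
(`exists_app_of_leftOut`), and the step `Q` only rewrites the argument `u`. The redexes of the
function part `s`, their relative unfoldings and the applicativity of their positions do not depend
on `u` (`IsUseful.replace_arg`). Hence `D` stays a redex at the same path, is still not useful, and
this is its only residual (`residual_replace_arg_iff`): in a term whose only mark is the anchor of
`D`, the mark lies in `s`, and the content substituted by `Q`, which comes from `H` or `C`, carries
none.

If moreover `Q` is the leftmost-outermost useful redex, no useful redex `P` of the target precedes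
the residual of `D` (`IsLOU.leftOut_replace_arg`). On the positions of one term the left-to-right
outside-in order is the lexicographic order of paths, so `P` can be compared with `Q`, which is
still a position of the target. If `P` is to the left of `Q`, it was useful before the step,
contradicting the choice of `Q`. If `P` is outside `Q`, it is a `dB`-redex, and it was not one
before the step only if the step created it; then the hole of `Q` is separated from the application
`P` by explicit substitutions only, so `P` lies in the argument part of `H⟨s ⟨·⟩⟩`, after `D`.

Standardness follows by induction on the derivation (`LOUDeriv.not_residualAfter`): a redex
preceding a leftmost-outermost useful step is not useful, so its unique residual is not useful and
precedes the next step, and it is never reduced.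
-/

namespace LSC

/-! ### Algebra of contexts -/

namespace Ctx

variable {A : Type}

theorem plug_comp (C D : Ctx A) (s : Term A) : (C.comp D).plug s = C.plug (D.plug s) := by
  induction C <;> simp_all [comp, plug]

theorem comp_assoc (C D E : Ctx A) : (C.comp D).comp E = C.comp (D.comp E) := by
  induction C <;> simp_all [comp]

theorem comp_hole (C : Ctx A) : C.comp hole = C := by
  induction C <;> simp_all [comp]

theorem depth_comp (C D : Ctx A) : (C.comp D).depth = C.depth + D.depth := by
  induction C <;> simp_all [comp, depth] <;> omega

theorem shallow_comp (C D : Ctx A) : (C.comp D).Shallow ↔ C.Shallow ∧ D.Shallow := by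
  induction C <;> simp_all [comp, Shallow]

theorem plug_injective (C : Ctx A) {s s' : Term A} (h : C.plug s = C.plug s') : s = s' := by
  induction C <;> simp_all [plug]

/-- Two decompositions of one context are nested. -/
theorem comp_eq_comp {C D C' D' : Ctx A} (h : C.comp D = C'.comp D') :
    (∃ K, C = C'.comp K ∧ D' = K.comp D) ∨ (∃ K, C' = C.comp K ∧ D = K.comp D') := by
  induction C generalizing C' with
  | hole => exact .inr ⟨C', rfl, h⟩
  | _ =>
    rename_i ih
    cases C' with
    | hole => exact .inl ⟨_, rfl, h.symm⟩
    | _ =>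
      simp only [comp, reduceCtorEq, lam.injEq, appL.injEq, appR.injEq, esL.injEq,
        esR.injEq] at h
      try
        obtain ⟨h₁, h₂⟩ := h
        first
          | subst h₂
            rcases ih h₁ with ⟨K, rfl, hK⟩ | ⟨K, rfl, hK⟩
            · exact .inl ⟨K, rfl, hK⟩
            · exact .inr ⟨K, rfl, hK⟩
          | subst h₁
            rcases ih h₂ with ⟨K, rfl, hK⟩ | ⟨K, rfl, hK⟩
            · exact .inl ⟨K, rfl, hK⟩
            · exact .inr ⟨K, rfl, hK⟩

theorem plug_eq_var {C : Ctx A} {s : Term A} {a : A} {n : ℕ} (h : C.plug s = Term.var a n) :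
    C = hole := by
  cases C <;> simp_all [plug]

theorem IsSubst.eq_hole_or_esL {L : Ctx A} (h : L.IsSubst) :
    L = hole ∨ ∃ (L' : Ctx A) (u : Term A), L = esL L' u ∧ L'.IsSubst := by
  cases L <;> simp_all [IsSubst]

theorem IsSubst.of_comp_right {K D : Ctx A} (h : (K.comp D).IsSubst) : D.IsSubst := by
  induction K <;> simp_all [comp, IsSubst]

/-- An abstraction surrounded by explicit substitutions determines its decomposition. -/
theorem IsSubst.plug_lam_inj {L L' : Ctx A} {a a' : A} {s s' : Term A} (hL : L.IsSubst)
    (hL' : L'.IsSubst) (h : L.plug (Term.lam a s) = L'.plug (Term.lam a' s')) :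
    L = L' ∧ a = a' ∧ s = s' := by
  induction L generalizing L' with
  | hole => cases L' <;> simp_all [plug, IsSubst]
  | esL L u ih =>
    cases L' with
    | esL L' u' =>
      simp only [plug, Term.es.injEq] at h
      obtain ⟨rfl, rfl, rfl⟩ := ih (L' := L') hL hL' h.1
      simp [h.2]
    | _ => simp_all [plug, IsSubst]
  | _ => simp_all [IsSubst]

/-- The abstraction of a `dB`-redex determines the redex. -/
theorem comp_appL_inj {D D' L L' : Ctx A} {u u' : Term A} (hL : L.IsSubst) (hL' : L'.IsSubst)
    (h : D.comp (appL L u) = D'.comp (appL L' u')) : D = D' := by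
  rcases comp_eq_comp h with ⟨K, rfl, hK⟩ | ⟨K, rfl, hK⟩
  · cases K with
    | hole => simp [comp_hole]
    | appL K v =>
      simp only [comp, appL.injEq] at hK
      rw [hK.1] at hL'
      exact absurd hL'.of_comp_right (by simp [IsSubst])
    | _ => simp [comp] at hK
  · cases K with
    | hole => simp [comp_hole]
    | appL K v =>
      simp only [comp, appL.injEq] at hK
      rw [hK.1] at hL
      exact absurd hL.of_comp_right (by simp [IsSubst])
    | _ => simp [comp] at hK

/-- Changing what fills a context `K` on the function side of an application creates a `dB`-redex
only if the hole of `K` lies under explicit substitutions alone. -/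
theorem plug_eq_subst_lam {K L : Ctx A} {r : Term A} {a : A} {s : Term A} (hL : L.IsSubst)
    (h : K.plug r = L.plug (Term.lam a s)) (hK : ¬ K.IsSubst) (r' : Term A) :
    ∃ (L' : Ctx A) (a' : A) (s' : Term A), L'.IsSubst ∧ K.plug r' = L'.plug (Term.lam a' s') := by
  induction K generalizing L with
  | hole => simp [IsSubst] at hK
  | lam b K ih => exact ⟨hole, b, K.plug r', trivial, rfl⟩
  | appL K u ih =>
    rcases hL.eq_hole_or_esL with rfl | ⟨L', v, rfl, hL'⟩ <;> simp [plug] at h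
  | appR t K ih =>
    rcases hL.eq_hole_or_esL with rfl | ⟨L', v, rfl, hL'⟩ <;> simp [plug] at h
  | esL K u ih =>
    rcases hL.eq_hole_or_esL with rfl | ⟨L', v, rfl, hL'⟩
    · simp [plug] at h
    · simp only [plug, Term.es.injEq] at h
      obtain ⟨L₁, a', s', hL₁, e⟩ := ih hL' h.1 hK
      exact ⟨esL L₁ u, a', s', hL₁, by simp [plug, e]⟩
  | esR t K ih =>
    rcases hL.eq_hole_or_esL with rfl | ⟨L', v, rfl, hL'⟩
    · simp [plug] at h
    · simp only [plug, Term.es.injEq] at h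
      exact ⟨esL L' (K.plug r'), a, s, hL', by simp [plug, h.1]⟩

/-! ### The order as the lexicographic order of paths -/

/-- The path from the root to the hole of a context: `true` stands for the argument of an
application and for the content of an explicit substitution, `false` for any other descent. -/
def path : Ctx A → List Bool
  | hole => []
  | lam _ C => false :: C.path
  | appL C _ => false :: C.path
  | appR _ C => true :: C.path
  | esL C _ => false :: C.path
  | esR _ C => true :: C.path

theorem path_comp (C D : Ctx A) : (C.comp D).path = C.path ++ D.path := by
  induction C <;> simp_all [comp, path]

theorem path_eq_nil {C : Ctx A} : C.path = [] ↔ C = hole := by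
  cases C <;> simp [path]

end Ctx

open Ctx

theorem append_lt_append_left_iff (l : List Bool) {a b : List Bool} : l ++ a < l ++ b ↔ a < b := by
  induction l <;> simp_all

theorem outIn_iff {C D : LCtx} : OutIn C D ↔ ∃ K : LCtx, K ≠ hole ∧ D = C.comp K := by
  constructor
  · intro h
    induction h with
    | root C hC => exact ⟨C, hC, rfl⟩
    | closure E C D _ ih =>
      obtain ⟨K, hK, rfl⟩ := ih
      exact ⟨K, hK, (comp_assoc _ _ _).symm⟩
  · rintro ⟨K, hK, rfl⟩
    simpa [comp_hole] using OutIn.closure C _ _ (OutIn.root K hK)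

/-- The left-to-right order, with its closure by contexts made explicit. -/
theorem LeftRight.exists_comp {P Q : LCtx} (h : LeftRight P Q) :
    ∃ (E C D : LCtx) (t u : LTerm), C.PrefixOf t ∧ D.PrefixOf u ∧
      ((P = E.comp (appL C u) ∧ Q = E.comp (appR t D)) ∨
       (P = E.comp (esL C u) ∧ Q = E.comp (esR t D))) := by
  induction h with
  | app C D t u hC hD => exact ⟨hole, C, D, t, u, hC, hD, .inl ⟨rfl, rfl⟩⟩
  | es C D t u hC hD => exact ⟨hole, C, D, t, u, hC, hD, .inr ⟨rfl, rfl⟩⟩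
  | closure E P Q _ ih =>
    obtain ⟨E', C, D, t, u, hC, hD, ⟨rfl, rfl⟩ | ⟨rfl, rfl⟩⟩ := ih
    · exact ⟨E.comp E', C, D, t, u, hC, hD, .inl ⟨by rw [comp_assoc], by rw [comp_assoc]⟩⟩
    · exact ⟨E.comp E', C, D, t, u, hC, hD, .inr ⟨by rw [comp_assoc], by rw [comp_assoc]⟩⟩

theorem LeftOut.path_lt {C D : LCtx} (h : LeftOut C D) : C.path < D.path := by
  rcases h with h | h
  · obtain ⟨K, hK, rfl⟩ := outIn_iff.1 h
    rw [path_comp]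
    conv_lhs => rw [← List.append_nil C.path]
    rw [append_lt_append_left_iff]
    cases K <;> simp_all [path]
  · obtain ⟨E, C, D, t, u, -, -, ⟨rfl, rfl⟩ | ⟨rfl, rfl⟩⟩ := h.exists_comp <;>
      simp [path_comp, append_lt_append_left_iff, path, List.cons_lt_cons_iff]

theorem LeftOut.comp {C D : LCtx} (E : LCtx) (h : LeftOut C D) :
    LeftOut (E.comp C) (E.comp D) :=
  h.imp (OutIn.closure E C D) (LeftRight.closure E C D)

/-- On the positions of one term, the left-to-right outside-in order contains the lexicographic
order of paths, and hence is equal to it by `LeftOut.path_lt`. -/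
theorem leftOut_of_path_lt {C D : LCtx} {s s' : LTerm} (e : C.plug s = D.plug s')
    (h : C.path < D.path) : LeftOut C D := by
  induction C generalizing D with
  | hole => exact .inl (.root D (by rintro rfl; simp [path] at h))
  | lam a C ih =>
    cases D <;> simp [plug, path] at e h
    exact (ih e h).comp (.lam _ .hole)
  | appL C u ih =>
    cases D <;> simp [plug, path] at e h
    · rw [e.2]
      exact (ih e.1 h).comp (.appL .hole _)
    · exact .inr (.app _ _ _ _ ⟨_, e.1⟩ ⟨_, e.2.symm⟩)
  | appR t C ih =>
    cases D <;> simp [plug, path] at e h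
    · exact absurd h (by simp [List.cons_lt_cons_iff])
    · rw [e.1]
      exact (ih e.2 h).comp (.appR _ .hole)
  | esL C u ih =>
    cases D <;> simp [plug, path] at e h
    · rw [e.2]
      exact (ih e.1 h).comp (.esL .hole _)
    · exact .inr (.es _ _ _ _ ⟨_, e.1⟩ ⟨_, e.2.symm⟩)
  | esR t C ih =>
    cases D <;> simp [plug, path] at e h
    · exact absurd h (by simp [List.cons_lt_cons_iff])
    · rw [e.1]
      exact (ih e.2 h).comp (.esR _ .hole)

theorem Ctx.eq_of_path_eq {A : Type} {C D : Ctx A} {s s' : Term A} (e : C.plug s = D.plug s')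
    (h : C.path = D.path) : C = D := by
  induction C generalizing D with
  | hole => exact (path_eq_nil.1 h.symm).symm
  | _ =>
    rename_i ih
    cases D <;> simp [plug, path] at e h
    all_goals
      first
        | rw [e.1, ih e.2 h]
        | rw [e.2, ih e.1 h]

theorem LeftOut.asymm {C D : LCtx} (h : LeftOut C D) : ¬ LeftOut D C :=
  fun h' => lt_asymm h.path_lt h'.path_lt

/-! ### Steps -/

variable {A : Type}

theorem Step.exists_plug {t t' : Term A} {C : Ctx A} (h : Step t C t') :
    ∃ r r' : Term A, t = C.plug r ∧ t' = C.plug r' := by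
  rcases h with ⟨r, r', -, h, h'⟩ | ⟨r, ⟨F, G, u, a, -, h, -⟩, h'⟩
  exacts [⟨r, r', h, h'⟩, ⟨_, r, h, h'⟩]

theorem RootDB.det {r s s' : Term A} (h : RootDB r s) (h' : RootDB r s') : s = s' := by
  obtain ⟨L, hL, a, t, u⟩ := h
  generalize e : Term.app (L.plug (Term.lam a t)) u = r at h'
  obtain ⟨L', hL', a', t', u'⟩ := h'
  simp only [Term.app.injEq] at e
  obtain ⟨rfl, rfl, rfl⟩ := hL.plug_lam_inj hL' e.1
  rw [e.2]

theorem IsLS.det {t : Term A} {C : Ctx A} {r r' : Term A} (h : IsLS t C r) (h' : IsLS t C r') :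
    r = r' := by
  obtain ⟨F, G, u, a, rfl, rfl, rfl⟩ := h
  obtain ⟨F', G', u', a', hC, ht, rfl⟩ := h'
  have hd := plug_injective _ ht
  simp only [Term.var.injEq] at hd
  -- the binder of the variable is the one at distance `G.depth` from the hole
  rcases comp_eq_comp hC with ⟨K, rfl, hK⟩ | ⟨K, rfl, hK⟩
  all_goals
    cases K <;> simp only [Ctx.comp, esL.injEq, reduceCtorEq] at hK
    · rw [hK.2, hd.2]
    · have := congrArg Ctx.depth hK.1
      simp only [depth_comp, Ctx.depth] at this
      omega

theorem Step.det {t s s' : Term A} {C : Ctx A} (h : Step t C s) (h' : Step t C s') : s = s' := by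
  rcases h with ⟨r, r', hr, rfl, rfl⟩ | ⟨r, hr, rfl⟩ <;>
    rcases h' with ⟨q, q', hq, e, rfl⟩ | ⟨q, hq, rfl⟩
  · obtain rfl := plug_injective _ e
    rw [hr.det hq]
  · obtain ⟨F, G, u, a, -, e, -⟩ := hq
    obtain rfl := plug_injective _ e
    cases hr
  · obtain ⟨F, G, u, a, -, e', -⟩ := hr
    obtain rfl := plug_injective _ (e'.symm.trans e)
    cases hq
  · rw [hr.det hq]

theorem IsDB.isRedex {t : LTerm} {C : LCtx} (h : IsDB t C) : IsRedex t C := by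
  obtain ⟨r, r', hr, rfl⟩ := h
  exact ⟨_, .inl ⟨r, r', hr, rfl, rfl⟩⟩

theorem IsLS.isRedex {t r : LTerm} {C : LCtx} (h : IsLS t C r) : IsRedex t C :=
  ⟨_, .inr ⟨r, h, rfl⟩⟩

theorem isRedex_iff {t : LTerm} {C : LCtx} : IsRedex t C ↔ IsDB t C ∨ ∃ r, IsLS t C r := by
  constructor
  · rintro ⟨t', ⟨r, r', hr, h, -⟩ | ⟨r, hr, -⟩⟩
    exacts [.inl ⟨r, r', hr, h⟩, .inr ⟨r, hr⟩]
  · rintro (h | ⟨r, h⟩)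
    exacts [h.isRedex, h.isRedex]

theorem IsUseful.isRedex {t : LTerm} {C : LCtx} (h : IsUseful t C) : IsRedex t C :=
  isRedex_iff.2 (h.2.imp_right fun ⟨r, hr, _⟩ => ⟨r, hr⟩)

/-! ### Redexes in the function part of an application

Rewriting the argument of an application changes neither the redexes of its function part nor
their usefulness. -/

theorem IsDB.replace_arg {t : Term A} {H B : Ctx A} {u : Term A}
    (h : IsDB t (H.comp (appL B u))) {s : Term A} (e : t = H.plug (Term.app s u)) (u' : Term A) :
    IsDB (H.plug (Term.app s u')) (H.comp (appL B u')) := by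
  obtain ⟨r, r', hr, rfl⟩ := h
  rw [plug_comp] at e
  have := plug_injective _ e
  simp only [plug, Term.app.injEq, and_true] at this
  exact ⟨r, r', hr, by simp [plug_comp, plug, this]⟩

theorem IsLS.replace_arg {t : Term A} {H B : Ctx A} {u r : Term A}
    (h : IsLS t (H.comp (appL B u)) r) {s : Term A} (e : t = H.plug (Term.app s u))
    (u' : Term A) :
    IsLS (H.plug (Term.app s u')) (H.comp (appL B u')) r := by
  obtain ⟨F, G, w, a, hC, rfl, rfl⟩ := h
  rw [plug_comp] at e
  have := plug_injective _ e
  simp only [plug, Term.app.injEq, and_true] at this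
  subst this
  rcases comp_eq_comp hC with ⟨K, rfl, hK⟩ | ⟨K, rfl, hK⟩
  · cases K <;> simp only [Ctx.comp, esL.injEq, reduceCtorEq] at hK
    rename_i K v
    obtain ⟨rfl, rfl⟩ := hK
    exact ⟨F, K.comp (appL B u'), w, a, by simp [comp_assoc, Ctx.comp],
      by simp [plug_comp, plug, depth_comp, depth], by simp [depth_comp, depth]⟩
  · cases K <;> simp only [Ctx.comp, appL.injEq, reduceCtorEq] at hK
    obtain ⟨rfl, rfl⟩ := hK
    rename_i K
    exact ⟨H.comp (appL K u'), G, w, a, by simp [comp_assoc, Ctx.comp],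
      by simp [plug_comp, plug], rfl⟩

theorem lamDepth_replace_arg (H B : Ctx A) (u u' : Term A) :
    (H.comp (appL B u)).lamDepth = (H.comp (appL B u')).lamDepth := by
  induction H <;> simp_all [Ctx.comp, lamDepth]

theorem relUnfold_replace_arg (H B : Ctx A) (u u' r : Term A) :
    relUnfold r (H.comp (appL B u)) = relUnfold r (H.comp (appL B u')) := by
  induction H <;> simp_all [Ctx.comp, relUnfold, lamDepth_replace_arg _ B u u']

theorem Ctx.Applicative.replace_arg {H B : Ctx A} {u : Term A}
    (h : (H.comp (appL B u)).Applicative) (u' : Term A) : (H.comp (appL B u')).Applicative := by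
  obtain ⟨D, L, v, hD, hL, e⟩ := h
  rcases comp_eq_comp e with ⟨K, rfl, hK⟩ | ⟨K, rfl, hK⟩
  · cases K <;> simp only [Ctx.comp, appL.injEq, reduceCtorEq] at hK
    · obtain ⟨rfl, rfl⟩ := hK
      exact ⟨D, L, u', hD, hL, by simp [comp_hole]⟩
    · rw [hK.1] at hL
      exact absurd hL.of_comp_right (by simp [IsSubst])
  · cases K <;> simp only [Ctx.comp, appL.injEq, reduceCtorEq] at hK
    · obtain ⟨rfl, rfl⟩ := hK
      exact ⟨H, B, u', by simpa [comp_hole] using hD, hL, rfl⟩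
    · obtain ⟨rfl, rfl⟩ := hK
      rename_i K
      refine ⟨H.comp (appL K u'), L, v, ?_, hL, by simp [comp_assoc, Ctx.comp]⟩
      simpa [shallow_comp, Shallow] using hD

theorem IsUseful.replace_arg {t : LTerm} {H B : LCtx} {u : LTerm}
    (h : IsUseful t (H.comp (appL B u))) {s : LTerm} (e : t = H.plug (Term.app s u))
    (u' : LTerm) :
    IsUseful (H.plug (Term.app s u')) (H.comp (appL B u')) := by
  obtain ⟨hS, h⟩ := h
  refine ⟨by simpa [shallow_comp, Shallow] using hS, ?_⟩
  rcases h with h | ⟨r, h, h'⟩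
  · exact .inl (h.replace_arg e u')
  · refine .inr ⟨r, h.replace_arg e u', ?_⟩
    rw [relUnfold_replace_arg H B u' u r]
    exact h'.imp_right fun h' => ⟨h'.1, h'.2.replace_arg u'⟩

theorem IsRedex.replace_arg {t : LTerm} {H B : LCtx} {u : LTerm}
    (h : IsRedex t (H.comp (appL B u))) {s : LTerm} (e : t = H.plug (Term.app s u))
    (u' : LTerm) :
    IsRedex (H.plug (Term.app s u')) (H.comp (appL B u')) := by
  rw [isRedex_iff] at h ⊢
  exact h.imp (fun h => h.replace_arg e u') fun ⟨r, h⟩ => ⟨r, h.replace_arg e u'⟩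

/-- A non-useful redex preceding a shallow one lies in the function part of an application whose
argument contains the latter. Indeed an `ls`-redex contains no position but its own, a
`dB`-redex outside a shallow one is shallow, hence useful, and nothing shallow lies in the
content of an explicit substitution. -/
theorem exists_app_of_leftOut {t p : LTerm} {D Q : LCtx} (hD : IsRedex t D)
    (hDu : ¬ IsUseful t D) (hQ : Q.Shallow) (hs : Step t Q p) (h : LeftOut D Q) :
    ∃ (H B C : LCtx) (s r r' : LTerm), D = H.comp (appL B (C.plug r)) ∧
      Q = H.comp (appR s C) ∧ t = H.plug (Term.app s (C.plug r)) ∧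
      p = H.plug (Term.app s (C.plug r')) := by
  obtain ⟨r, r', rfl, rfl⟩ := hs.exists_plug
  rcases h with h | h
  · obtain ⟨K, hK, rfl⟩ := outIn_iff.1 h
    rw [shallow_comp] at hQ
    rcases isRedex_iff.1 hD with h | ⟨q, F, G, u, a, -, e, -⟩
    · exact absurd ⟨hQ.1, .inl h⟩ hDu
    · rw [plug_comp] at e
      exact absurd (plug_eq_var (plug_injective _ e)) hK
  · obtain ⟨E, B, C, s, u, -, -, ⟨rfl, rfl⟩ | ⟨rfl, rfl⟩⟩ := h.exists_comp
    · obtain ⟨q, q', e, -⟩ := hD.choose_spec.exists_plug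
      simp only [plug_comp] at e
      have := plug_injective _ e
      simp only [plug, Term.app.injEq] at this
      obtain ⟨rfl, rfl⟩ := this
      exact ⟨E, B, C, _, r, r', rfl, rfl, by simp [plug_comp, plug], by simp [plug_comp, plug]⟩
    · simp [shallow_comp, Shallow] at hQ

/-! ### Labels and marks -/

theorem Term.erase_shift (t : Term A) (c k : ℕ) : (t.shift c k).erase = t.erase.shift c k := by
  induction t generalizing c <;> simp_all [shift, erase]

theorem Term.markCount_shift (t : Term Bool) (c k : ℕ) :
    (t.shift c k).markCount = t.markCount := by
  induction t generalizing c <;> simp_all [shift, markCount]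

namespace Ctx

theorem erase_plug (C : Ctx A) (s : Term A) : (C.plug s).erase = C.erase.plug s.erase := by
  induction C <;> simp_all [plug, erase, Term.erase]

theorem erase_comp (C D : Ctx A) : (C.comp D).erase = C.erase.comp D.erase := by
  induction C <;> simp_all [comp, erase]

theorem depth_erase (C : Ctx A) : C.erase.depth = C.depth := by
  induction C <;> simp_all [erase, depth]

theorem isSubst_erase (C : Ctx A) : C.erase.IsSubst ↔ C.IsSubst := by
  induction C <;> simp_all [erase, IsSubst]

theorem exists_plug_of_erase {T : Term A} {C : LCtx} {s : LTerm} (h : T.erase = C.plug s) :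
    ∃ (C₁ : Ctx A) (S : Term A), T = C₁.plug S ∧ C₁.erase = C ∧ S.erase = s := by
  induction C generalizing T with
  | hole => exact ⟨hole, T, rfl, rfl, h⟩
  | lam a C ih =>
    cases T <;> simp [Term.erase, plug] at h
    obtain ⟨C₁, S, rfl, rfl, rfl⟩ := ih h
    exact ⟨lam _ C₁, S, rfl, rfl, rfl⟩
  | appL C u ih =>
    cases T <;> simp [Term.erase, plug] at h
    obtain ⟨C₁, S, rfl, rfl, rfl⟩ := ih h.1
    exact ⟨appL C₁ _, S, rfl, by simp [erase, h.2], rfl⟩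
  | appR t C ih =>
    cases T <;> simp [Term.erase, plug] at h
    obtain ⟨C₁, S, rfl, rfl, rfl⟩ := ih h.2
    exact ⟨appR _ C₁, S, rfl, by simp [erase, h.1], rfl⟩
  | esL C u ih =>
    cases T <;> simp [Term.erase, plug] at h
    obtain ⟨C₁, S, rfl, rfl, rfl⟩ := ih h.1
    exact ⟨esL C₁ _, S, rfl, by simp [erase, h.2], rfl⟩
  | esR t C ih =>
    cases T <;> simp [Term.erase, plug] at h
    obtain ⟨C₁, S, rfl, rfl, rfl⟩ := ih h.2
    exact ⟨esR _ C₁, S, rfl, by simp [erase, h.1], rfl⟩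

theorem exists_comp_of_erase {C : Ctx A} {F D : LCtx} (h : C.erase = F.comp D) :
    ∃ F₁ D₁ : Ctx A, C = F₁.comp D₁ ∧ F₁.erase = F ∧ D₁.erase = D := by
  induction F generalizing C with
  | hole => exact ⟨hole, C, rfl, rfl, h⟩
  | lam a F ih =>
    cases C <;> simp [erase, comp] at h
    obtain ⟨F₁, D₁, rfl, rfl, rfl⟩ := ih h
    exact ⟨lam _ F₁, D₁, rfl, rfl, rfl⟩
  | appL F u ih =>
    cases C <;> simp [erase, comp] at h
    obtain ⟨F₁, D₁, rfl, rfl, rfl⟩ := ih h.1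
    exact ⟨appL F₁ _, D₁, rfl, by simp [erase, h.2], rfl⟩
  | appR t F ih =>
    cases C <;> simp [erase, comp] at h
    obtain ⟨F₁, D₁, rfl, rfl, rfl⟩ := ih h.2
    exact ⟨appR _ F₁, D₁, rfl, by simp [erase, h.1], rfl⟩
  | esL F u ih =>
    cases C <;> simp [erase, comp] at h
    obtain ⟨F₁, D₁, rfl, rfl, rfl⟩ := ih h.1
    exact ⟨esL F₁ _, D₁, rfl, by simp [erase, h.2], rfl⟩
  | esR t F ih =>
    cases C <;> simp [erase, comp] at h
    obtain ⟨F₁, D₁, rfl, rfl, rfl⟩ := ih h.2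
    exact ⟨esR _ F₁, D₁, rfl, by simp [erase, h.1], rfl⟩

theorem path_erase (C : Ctx A) : C.erase.path = C.path := by
  induction C <;> simp_all [erase, path]

theorem plug_inj_of_erase_eq {C D : Ctx A} {s s' : Term A} (h : C.erase = D.erase)
    (e : C.plug s = D.plug s') : C = D ∧ s = s' := by
  obtain rfl : C = D := eq_of_path_eq e (by rw [← path_erase C, h, path_erase])
  exact ⟨rfl, plug_injective _ e⟩

/-- The number of marks in a `Bool`-labelled context. -/
def markCount : Ctx Bool → ℕ
  | hole => 0
  | lam a C => a.toNat + C.markCount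
  | appL C u => C.markCount + u.markCount
  | appR t C => t.markCount + C.markCount
  | esL C u => C.markCount + u.markCount
  | esR t C => t.markCount + C.markCount

theorem markCount_plug (C : Ctx Bool) (s : Term Bool) :
    (C.plug s).markCount = C.markCount + s.markCount := by
  induction C <;> simp_all [plug, markCount, Term.markCount] <;> omega

theorem markCount_comp (C D : Ctx Bool) :
    (C.comp D).markCount = C.markCount + D.markCount := by
  induction C <;> simp_all [comp, markCount] <;> omega

end Ctx

/-- Label every variable occurrence and every abstraction with `false`. -/
def Term.unmarked : LTerm → Term Bool
  | .var _ n => .var false n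
  | .lam _ t => .lam false t.unmarked
  | .app t u => .app t.unmarked u.unmarked
  | .es t u => .es t.unmarked u.unmarked

/-- Label every variable occurrence and every abstraction of a context with `false`. -/
def Ctx.unmarked : LCtx → Ctx Bool
  | .hole => .hole
  | .lam _ C => .lam false C.unmarked
  | .appL C u => .appL C.unmarked u.unmarked
  | .appR t C => .appR t.unmarked C.unmarked
  | .esL C u => .esL C.unmarked u.unmarked
  | .esR t C => .esR t.unmarked C.unmarked

theorem Term.erase_unmarked (t : LTerm) : t.unmarked.erase = t := by
  induction t <;> simp_all [unmarked, erase]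

theorem Term.markCount_unmarked (t : LTerm) : t.unmarked.markCount = 0 := by
  induction t <;> simp_all [unmarked, markCount]

theorem Ctx.erase_unmarked (C : LCtx) : C.unmarked.erase = C := by
  induction C <;> simp_all [unmarked, erase, Term.erase_unmarked]

theorem Ctx.markCount_unmarked (C : LCtx) : C.unmarked.markCount = 0 := by
  induction C <;> simp_all [unmarked, markCount, Term.markCount_unmarked]

/-- The anchor of a redex can be marked, and nothing else. -/
theorem IsRedex.exists_anchorMarked {t : LTerm} {D : LCtx} (h : IsRedex t D) :
    ∃ T : Term Bool, T.erase = t ∧ T.markCount = 1 ∧ AnchorMarked T D := by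
  rcases isRedex_iff.1 h with ⟨r, r', hr, rfl⟩ | ⟨r, F, G, u, a, -, rfl, -⟩
  · obtain ⟨L, hL, a, s, u⟩ := hr
    refine ⟨D.unmarked.plug (.app (L.unmarked.plug (.lam true s.unmarked)) u.unmarked), ?_, ?_,
      D.unmarked, D.erase_unmarked, .inr ⟨L.unmarked, _, _, ?_, rfl⟩⟩
    · simp [erase_plug, Term.erase, Term.erase_unmarked, Ctx.erase_unmarked]
    · simp [markCount_plug, Term.markCount, Term.markCount_unmarked, Ctx.markCount_unmarked]
    · rwa [← isSubst_erase, Ctx.erase_unmarked]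
  · refine ⟨D.unmarked.plug (.var true G.depth), ?_, ?_, D.unmarked, D.erase_unmarked,
      .inl ⟨_, rfl⟩⟩
    · simp [erase_plug, Term.erase, Ctx.erase_unmarked]
    · simp [markCount_plug, Term.markCount, Ctx.markCount_unmarked]

/-- A step of the underlying ordinary term can be performed on a labelled term. -/
theorem Step.lift {t t' : LTerm} {C : LCtx} (h : Step t C t') {T : Term A} (hT : T.erase = t) :
    ∃ (C₁ : Ctx A) (T' : Term A), C₁.erase = C ∧ T'.erase = t' ∧ Step T C₁ T' := by
  rcases h with ⟨r, r', hr, rfl, rfl⟩ | ⟨r, ⟨F, G, u, a, rfl, rfl, rfl⟩, rfl⟩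
  · obtain ⟨C₁, R, rfl, rfl, rfl⟩ := exists_plug_of_erase hT
    generalize e : R.erase = r at hr
    obtain ⟨L, hL, a, s, u⟩ := hr
    cases R <;> simp [Term.erase] at e
    rename_i R U
    obtain ⟨L₁, S, rfl, rfl, hS⟩ := exists_plug_of_erase e.1
    cases S <;> simp [Term.erase] at hS
    rename_i a' S
    obtain ⟨-, rfl⟩ := e
    subst hS
    refine ⟨C₁, _, rfl, ?_, .inl ⟨_, _, .intro L₁ ((isSubst_erase _).1 hL) a' S U, rfl, rfl⟩⟩
    simp [erase_plug, Term.erase, Term.erase_shift, depth_erase]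
  · obtain ⟨C₁, S, rfl, hC, hS⟩ := exists_plug_of_erase hT
    obtain ⟨F₁, D₁, rfl, rfl, hD⟩ := exists_comp_of_erase hC
    cases D₁ <;> simp [Ctx.erase] at hD
    rename_i G₁ u₁
    obtain ⟨rfl, rfl⟩ := hD
    cases S <;> simp [Term.erase] at hS
    subst hS
    refine ⟨_, _, hC, ?_, .inr ⟨_, ⟨F₁, G₁, u₁, _, rfl, by rw [depth_erase], rfl⟩, rfl⟩⟩
    simp [erase_plug, erase_comp, Ctx.erase, Term.erase_shift, depth_erase]

/-- A marked variable occurrence or a marked abstraction. -/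
def Term.HeadMarked (s : Term Bool) : Prop :=
  (∃ n, s = .var true n) ∨ ∃ b, s = .lam true b

theorem Term.HeadMarked.one_le {s : Term Bool} (h : s.HeadMarked) : 1 ≤ s.markCount := by
  rcases h with ⟨n, rfl⟩ | ⟨b, rfl⟩ <;> simp [Term.markCount]

/-- In a term with one mark, the mark has one position. -/
theorem Ctx.plug_headMarked_inj {C D : Ctx Bool} {s s' : Term Bool} (hs : s.HeadMarked)
    (hs' : s'.HeadMarked) (e : C.plug s = D.plug s') (h : (C.plug s).markCount ≤ 1) :
    C = D := by
  have h₁ := hs.one_le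
  have h₂ := hs'.one_le
  induction C generalizing D with
  | hole =>
    cases D with
    | hole => rfl
    | lam a' D =>
      simp only [plug] at e; subst e
      simp [Term.HeadMarked] at hs; subst hs
      simp [plug, Term.markCount, markCount_plug] at h; omega
    | _ => simp only [plug] at e; subst e; simp [Term.HeadMarked] at hs
  | lam a C ih =>
    cases D with
    | hole =>
      simp only [plug] at e; subst e
      simp [Term.HeadMarked] at hs'; subst hs'
      simp [plug, Term.markCount, markCount_plug] at h; omega
    | lam a' D =>
      simp only [plug, Term.lam.injEq] at e
      simp only [plug, Term.markCount] at h
      rw [e.1, ih e.2 (by omega)]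
    | _ => simp [plug] at e
  | appL C u ih =>
    cases D with
    | hole => simp only [plug] at e; subst e; simp [Term.HeadMarked] at hs'
    | appL D u' =>
      simp only [plug, Term.app.injEq] at e
      simp only [plug, Term.markCount] at h
      rw [e.2, ih e.1 (by omega)]
    | appR t D =>
      simp only [plug, Term.app.injEq] at e
      simp only [plug, Term.markCount, e.2, markCount_plug] at h
      omega
    | _ => simp [plug] at e
  | appR t C ih =>
    cases D with
    | hole => simp only [plug] at e; subst e; simp [Term.HeadMarked] at hs'
    | appR t' D =>
      simp only [plug, Term.app.injEq] at e
      simp only [plug, Term.markCount] at h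
      rw [e.1, ih e.2 (by omega)]
    | appL D u =>
      simp only [plug, Term.app.injEq] at e
      simp only [plug, Term.markCount, e.1, markCount_plug] at h
      omega
    | _ => simp [plug] at e
  | esL C u ih =>
    cases D with
    | hole => simp only [plug] at e; subst e; simp [Term.HeadMarked] at hs'
    | esL D u' =>
      simp only [plug, Term.es.injEq] at e
      simp only [plug, Term.markCount] at h
      rw [e.2, ih e.1 (by omega)]
    | esR t D =>
      simp only [plug, Term.es.injEq] at e
      simp only [plug, Term.markCount, e.2, markCount_plug] at h
      omega
    | _ => simp [plug] at e
  | esR t C ih =>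
    cases D with
    | hole => simp only [plug] at e; subst e; simp [Term.HeadMarked] at hs'
    | esR t' D =>
      simp only [plug, Term.es.injEq] at e
      simp only [plug, Term.markCount] at h
      rw [e.1, ih e.2 (by omega)]
    | esL D u =>
      simp only [plug, Term.es.injEq] at e
      simp only [plug, Term.markCount, e.1, markCount_plug] at h
      omega
    | _ => simp [plug] at e

/-- A single mark anchors at most one redex. -/
theorem AnchorMarked.unique {T : Term Bool} {D D' : LCtx} (h : AnchorMarked T D)
    (h' : AnchorMarked T D') (hT : T.markCount ≤ 1) : D = D' := by
  obtain ⟨D₁, rfl, ⟨n, rfl⟩ | ⟨L, s, u, hL, rfl⟩⟩ := h <;>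
    obtain ⟨D₂, rfl, ⟨m, e⟩ | ⟨L', s', u', hL', e⟩⟩ := h'
  · rw [plug_headMarked_inj (.inl ⟨_, rfl⟩) (.inl ⟨_, rfl⟩) e hT]
  · change _ = D₂.plug ((appL L' u').plug _) at e
    rw [← plug_comp] at e
    obtain rfl := plug_headMarked_inj (.inl ⟨_, rfl⟩) (.inr ⟨_, rfl⟩) e hT
    simpa using plug_injective _ e
  · change D₁.plug ((appL L u).plug _) = _ at e
    rw [← plug_comp] at e
    change (D₁.plug ((appL L u).plug _)).markCount ≤ 1 at hT
    rw [← plug_comp] at hT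
    obtain rfl := plug_headMarked_inj (.inr ⟨_, rfl⟩) (.inl ⟨_, rfl⟩) e hT
    simpa using plug_injective _ e
  · change D₁.plug ((appL L u).plug _) = D₂.plug ((appL L' u').plug _) at e
    change (D₁.plug ((appL L u).plug _)).markCount ≤ 1 at hT
    rw [← plug_comp] at hT
    rw [← plug_comp, ← plug_comp] at e
    rw [comp_appL_inj hL hL' (plug_headMarked_inj (.inr ⟨_, rfl⟩) (.inr ⟨_, rfl⟩) e hT)]

/-! ### Residuals of redexes in the function part of an application -/

theorem AnchorMarked.exists_plug {T : Term Bool} {D : LCtx} (h : AnchorMarked T D) :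
    ∃ (D₁ : Ctx Bool) (X : Term Bool), D₁.erase = D ∧ T = D₁.plug X ∧ 1 ≤ X.markCount ∧
      ∀ D₂ : Ctx Bool, AnchorMarked (D₂.plug X) D₂.erase := by
  obtain ⟨D₁, rfl, ⟨n, rfl⟩ | ⟨L, s, u, hL, rfl⟩⟩ := h
  · exact ⟨D₁, _, rfl, rfl, by simp [Term.markCount], fun D₂ => ⟨D₂, rfl, .inl ⟨n, rfl⟩⟩⟩
  · exact ⟨D₁, _, rfl, rfl, by simp [Term.markCount, markCount_plug]; omega,
      fun D₂ => ⟨D₂, rfl, .inr ⟨L, s, u, hL, rfl⟩⟩⟩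

/-- A step in the argument of an application, performed on a term whose only mark is in the
function part, creates no mark: the substituted content lies outside the function part. -/
theorem Step.markCount_le {T T' : Term Bool} {H C : Ctx Bool} {s : Term Bool}
    (h : Step T (H.comp (appR s C)) T') (hT : T.markCount ≤ 1) (hs : 1 ≤ s.markCount) :
    T'.markCount ≤ 1 := by
  rcases h with ⟨r, r', hr, rfl, rfl⟩ | ⟨r, ⟨F, G, u, a, hC, rfl, rfl⟩, rfl⟩
  · obtain ⟨L, hL, a, t, u⟩ := hr
    simp only [markCount_plug, Term.markCount, Term.markCount_shift] at hT ⊢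
    omega
  · simp only [markCount_plug, markCount_comp, Ctx.markCount, Term.markCount_shift] at hT ⊢
    rcases comp_eq_comp hC with ⟨K, rfl, hK⟩ | ⟨K, rfl, hK⟩
    · cases K <;> simp only [Ctx.comp, esL.injEq, reduceCtorEq] at hK
      obtain ⟨rfl, rfl⟩ := hK
      simp only [markCount_comp, Ctx.markCount] at hT ⊢
      omega
    · cases K <;> simp only [Ctx.comp, appR.injEq, reduceCtorEq] at hK
      obtain ⟨rfl, rfl⟩ := hK
      simp only [markCount_comp, Ctx.markCount] at hT ⊢
      omega

/-- A redex in the function part of an application has, after a step in the argument, exactly one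
residual, the redex with the same path. -/
theorem residual_replace_arg_iff {H B C : LCtx} {s r r' : LTerm}
    (hD : IsRedex (H.plug (.app s (C.plug r))) (H.comp (appL B (C.plug r))))
    (hs : Step (H.plug (.app s (C.plug r))) (H.comp (appR s C)) (H.plug (.app s (C.plug r'))))
    (E : LCtx) :
    Residual (H.plug (.app s (C.plug r))) (H.comp (appR s C)) (H.plug (.app s (C.plug r')))
      (H.comp (appL B (C.plug r))) E ↔ E = H.comp (appL B (C.plug r')) := by
  have key : ∀ (T T' : Term Bool) (C₁ : Ctx Bool), C₁.erase = H.comp (appR s C) →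
      T'.erase = H.plug (.app s (C.plug r')) → T.markCount = 1 →
      AnchorMarked T (H.comp (appL B (C.plug r))) → Step T C₁ T' →
      AnchorMarked T' (H.comp (appL B (C.plug r'))) ∧ T'.markCount ≤ 1 := by
    intro T T' C₁ hC₁ hT' hT hA hS
    obtain ⟨R, R', rfl, rfl⟩ := hS.exists_plug
    obtain ⟨D₁, X, hD₁, eT, hX, hmark⟩ := hA.exists_plug
    obtain ⟨H₁, E₁, rfl, rfl, hE₁⟩ := exists_comp_of_erase hC₁
    cases E₁ <;> simp [Ctx.erase] at hE₁
    rename_i s₁ C₁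
    obtain ⟨rfl, rfl⟩ := hE₁
    obtain ⟨H₂, E₂, rfl, hH, hE₂⟩ := exists_comp_of_erase hD₁
    cases E₂ <;> simp [Ctx.erase] at hE₂
    rename_i B₁ u₁
    obtain ⟨rfl, hu₁⟩ := hE₂
    rw [plug_comp, plug_comp] at eT
    obtain ⟨rfl, e⟩ := plug_inj_of_erase_eq hH.symm eT
    simp only [plug, Term.app.injEq] at e
    obtain ⟨rfl, rfl⟩ := e
    refine ⟨?_, hS.markCount_le hT.le (by rw [markCount_plug]; omega)⟩
    have := hmark (H₁.comp (appL B₁ (C₁.plug R')))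
    rw [plug_comp, erase_plug] at hT'
    have hT' := plug_injective _ hT'
    simp only [plug, Term.erase, Term.app.injEq] at hT'
    rw [← hT'.2]
    simpa only [plug_comp, plug, erase_comp, Ctx.erase] using this
  constructor
  · rintro ⟨-, -, T, T', C₁, -, hC₁, hT', hT, hA, hS, hE⟩
    obtain ⟨hA', hT''⟩ := key T T' C₁ hC₁ hT' hT hA hS
    exact hE.unique hA' hT''
  · rintro rfl
    obtain ⟨T, hTe, hT, hA⟩ := hD.exists_anchorMarked
    obtain ⟨C₁, T', hC₁, hT', hS⟩ := hs.lift hTe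
    exact ⟨hD, hD.replace_arg rfl _, T, T', C₁, hTe, hC₁, hT', hT, hA, hS,
      (key T T' C₁ hC₁ hT' hT hA hS).1⟩

/-! ### Persistence and standardization -/

/-- After a leftmost-outermost useful step in the argument of an application, no useful redex
precedes a position of the function part that did not hold a useful redex before the step. -/
theorem IsLOU.leftOut_replace_arg {H B C : LCtx} {s r r' : LTerm}
    (hQ : IsLOU (H.plug (.app s (C.plug r))) (H.comp (appR s C)))
    (hB : B.PrefixOf s) {P : LCtx} (hP : IsUseful (H.plug (.app s (C.plug r'))) P) :
    LeftOut (H.comp (appL B (C.plug r'))) P := by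
  obtain ⟨b, rfl⟩ := hB
  obtain ⟨q, q', eP, -⟩ := hP.isRedex.choose_spec.exists_plug
  have eD : (H.comp (appL B (C.plug r'))).plug b = P.plug q := by
    rw [← eP]; simp [plug_comp, plug]
  have eQ : P.plug q = (H.comp (appR (B.plug b) C)).plug r' := by
    rw [← eP]; simp [plug_comp, plug]
  have hDQ : (H.comp (appL B (C.plug r'))).path < (H.comp (appR (B.plug b) C)).path := by
    simp [path_comp, append_lt_append_left_iff, path, List.cons_lt_cons_iff]
  apply leftOut_of_path_lt eD
  rcases lt_or_ge P.path (H.comp (appR (B.plug b) C)).path with hlt | hge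
  swap
  · exact hDQ.trans_le hge
  rcases leftOut_of_path_lt eQ hlt with h | h
  · obtain ⟨K, hK, e⟩ := outIn_iff.1 h
    have et : H.plug (.app (B.plug b) (C.plug r)) = P.plug (K.plug r) := by
      rw [← plug_comp, ← e]; simp [plug_comp, plug]
    have et' : K.plug r' = q := by
      rw [e, plug_comp] at eQ; exact (plug_injective _ eQ).symm
    -- a `dB`-redex at `P` before the step would contradict the choice of the step
    have notDB : ∀ (L : LCtx) (a : Unit) (c u : LTerm), L.IsSubst →
        K.plug r ≠ .app (L.plug (.lam a c)) u := by
      intro L a c u hL e'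
      have hu : IsUseful (H.plug (.app (B.plug b) (C.plug r))) P :=
        ⟨hP.1, .inl ⟨_, _, .intro L hL a c u, by rw [et, e']⟩⟩
      exact (hQ.2 P hu (by rintro rfl; exact LeftOut.asymm (.inl h) (.inl h))).asymm (.inl h)
    rcases hP.2 with ⟨x, x', hx, ex⟩ | ⟨x, ⟨F, G, u, a, -, ex, -⟩, -⟩
    · obtain ⟨L, hL, a, c, u⟩ := hx
      rw [ex] at eP
      obtain rfl := plug_injective _ eP
      cases K with
      | hole => exact absurd rfl hK
      | appL K v =>
        simp only [plug, Term.app.injEq] at et'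
        by_cases hKs : K.IsSubst
        · -- the step may create the redex at `P`: then `P` itself lies in the argument
          rcases comp_eq_comp e with ⟨M, rfl, hM⟩ | ⟨M, rfl, hM⟩
          · cases M <;> simp only [Ctx.comp, appL.injEq, reduceCtorEq] at hM
            rw [hM.1] at hKs
            exact absurd hKs.of_comp_right (by simp [IsSubst])
          · cases M <;> simp only [Ctx.comp, appR.injEq, reduceCtorEq] at hM
            simp [path_comp, append_lt_append_left_iff, path, List.cons_lt_cons_iff]
        · obtain ⟨L', a', c', hL', e'⟩ := plug_eq_subst_lam hL et'.1 hKs r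
          exact absurd (by rw [plug, e']) (notDB L' a' c' v hL')
      | appR v K =>
        simp only [plug, Term.app.injEq] at et'
        exact absurd (by rw [plug, et'.1]) (notDB L a c (K.plug r) hL)
      | _ => simp [plug] at et'
    · rw [ex] at eP
      obtain rfl := plug_injective _ eP
      exact absurd (plug_eq_var et') hK
  · obtain ⟨E, X, Y, v, w, -, -, ⟨rfl, e⟩ | ⟨rfl, e⟩⟩ := h.exists_comp
    · -- a redex on the left of the step was as useful before it
      rw [e] at eQ
      simp only [plug_comp] at eQ
      have := plug_injective _ eQ
      simp only [plug, Term.app.injEq] at this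
      obtain ⟨rfl, rfl⟩ := this
      have et : H.plug (.app (B.plug b) (C.plug r)) = E.plug (.app (X.plug q) (Y.plug r)) := by
        have : (H.comp (appR (B.plug b) C)).plug r = (E.comp (appR (X.plug q) Y)).plug r := by
          rw [e]
        simpa [plug_comp, plug] using this
      have hu := hP.replace_arg (s := X.plug q) (by rw [eP]; simp [plug_comp, plug]) (Y.plug r)
      rw [← et] at hu
      have hl : LeftOut (E.comp (appL X (Y.plug r))) (H.comp (appR (B.plug b) C)) := by
        rw [e]
        exact .inr (.closure _ _ _ (.app _ _ _ _ ⟨_, rfl⟩ ⟨_, rfl⟩))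
      exact absurd hl (hQ.2 _ hu (by rintro e'; rw [e'] at hl; exact hl.asymm hl)).asymm
    · have := hQ.1.1
      rw [e] at this
      simp [shallow_comp, Shallow] at this

/-- A redex that is not useful and precedes a useful step has exactly one residual, which is not
useful either, and which precedes all useful redexes if the step is leftmost-outermost. -/
theorem residual_of_not_useful {t p : LTerm} {D Q : LCtx} (hD : IsRedex t D)
    (hDu : ¬ IsUseful t D) (hQ : IsUseful t Q) (hs : Step t Q p) (h : LeftOut D Q) :
    ∃ D' : LCtx, (∀ E, Residual t Q p D E ↔ E = D') ∧ ¬ IsUseful p D' ∧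
      (D.Shallow → D'.Shallow) ∧ ((∃ r, IsLS t D r) → ∃ r, IsLS p D' r) ∧
      (IsLOU t Q → ∀ P, IsUseful p P → LeftOut D' P) := by
  obtain ⟨H, B, C, s, r, r', rfl, rfl, rfl, rfl⟩ := exists_app_of_leftOut hD hDu hQ.1 hs h
  refine ⟨_, residual_replace_arg_iff hD hs, fun hu => hDu (hu.replace_arg rfl _), ?_, ?_, ?_⟩
  · simp [shallow_comp, Shallow]
  · rintro ⟨q, hq⟩
    exact ⟨q, hq.replace_arg rfl _⟩
  · intro hL P hP
    obtain ⟨q, q', e, -⟩ := hD.choose_spec.exists_plug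
    rw [plug_comp] at e
    have := plug_injective _ e
    simp only [plug, Term.app.injEq] at this
    exact hL.leftOut_replace_arg ⟨q, this.1.symm⟩ hP

theorem LOUDeriv.deriv {t u : LTerm} {ρ : List LCtx} (h : LOUDeriv t ρ u) : Deriv t ρ u := by
  induction h with
  | nil t => exact .nil t
  | cons t s u C ρ _ hs _ ih => exact .cons t s u C ρ hs ih

theorem LOUDeriv.drop {t s u : LTerm} {τ ρ : List LCtx} (hτ : Deriv t τ s)
    (h : LOUDeriv t (τ ++ ρ) u) : LOUDeriv s ρ u := by
  induction hτ with
  | nil t => exact h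
  | cons t s' s C τ hs _ ih =>
    cases h with
    | cons _ s'' _ _ _ _ hs' h =>
      obtain rfl := hs.det hs'
      exact ih h

theorem IsLOU.not_useful {t : LTerm} {C D : LCtx} (hC : IsLOU t C) (h : LeftOut D C) :
    ¬ IsUseful t D :=
  fun hD => (hC.2 D hD (by rintro rfl; exact h.asymm h)).asymm h

/-- The residuals of a redex preceding the first step of a leftmost-outermost useful derivation
are never reduced. -/
theorem LOUDeriv.not_residualAfter {s u : LTerm} {C D E : LCtx} {σ ω : List LCtx}
    (h : LOUDeriv s (C :: (σ ++ E :: ω)) u) (hD : IsRedex s D) (hDC : LeftOut D C) :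
    ¬ ResidualAfter s (C :: σ) D E := by
  induction σ generalizing s C D with
  | nil =>
    intro hR
    cases h with
    | cons _ s' _ _ _ hC hs h =>
    cases hR with
    | cons _ s'' _ _ _ D₁ _ hs' hres hR =>
    obtain rfl := hs.det hs'
    cases hR
    obtain ⟨D', hD', hn, -⟩ := residual_of_not_useful hD (hC.not_useful hDC) hC.1 hs hDC
    obtain rfl := (hD' _).1 hres
    cases h with
    | cons _ _ _ _ _ hE _ _ => exact hn hE.1
  | cons C' σ ih =>
    intro hR
    cases h with
    | cons _ s' _ _ _ hC hs h =>
    cases hR with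
    | cons _ s'' _ _ _ D₁ _ hs' hres hR =>
    obtain rfl := hs.det hs'
    obtain ⟨D', hD', -, -, -, hn⟩ := residual_of_not_useful hD (hC.not_useful hDC) hC.1 hs hDC
    obtain rfl := (hD' _).1 hres
    have hC' : IsLOU s' C' := by
      cases h with
      | cons _ _ _ _ _ hC' _ _ => exact hC'
    exact ih h hres.2.1 (hn hC _ hC'.1) hR

end LSC

theorem mainTheorem8 :
    -- every leftmost-outermost useful derivation is standard
    (∀ (t u : LSC.LTerm) (ρ : List LSC.LCtx),
      LSC.LOUDeriv t ρ u → LSC.Deriv t ρ u ∧ LSC.Standard t ρ) ∧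
    -- useless persistence
    (∀ (t p : LSC.LTerm) (R Q : LSC.LCtx),
      LSC.IsUseless t R → LSC.IsUseful t Q → LSC.Step t Q p → LSC.LeftOut R Q →
        ∃ R' : LSC.LCtx,
          (∀ R'' : LSC.LCtx, LSC.Residual t Q p R R'' ↔ R'' = R') ∧
          R'.Shallow ∧ LSC.IsUseless p R' ∧
          (LSC.IsLOU t Q → ∀ P : LSC.LCtx, LSC.IsLOU p P → LSC.LeftOut R' P)) := by
  refine ⟨fun t u ρ h => ⟨h.deriv, ?_⟩, fun t p R Q hR hQ hs hl => ?_⟩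
  · rintro τ σ ω C E rfl s hτ D hD hDC
    exact (h.drop hτ).not_residualAfter hD hDC
  · obtain ⟨hRs, ⟨r, hr⟩, hn⟩ := hR
    obtain ⟨R', hres, hn', hs', hls, hlou⟩ :=
      LSC.residual_of_not_useful hr.isRedex hn hQ hs hl
    exact ⟨R', hres, hs' hRs, ⟨hs' hRs, hls ⟨r, hr⟩, hn'⟩, fun hL P hP => hlou hL P hP.1⟩
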